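/- Let $\mathcal X=\mathcal Y\subset\mathbb R^{n}$ be a compact set whose boundary has Lebesgue measure zero, and let $\mathcal P(\mathcal X)$ be the set of Borel probability measures on $\mathcal X$. Let $\mathbb P,\mathbb Q\in\mathcal P(\mathcal X)$ with $\mathbb P\neq\mathbb Q$ and $\mathbb P$ absolutely continuous with respect to Lebesgue measure, let $p>1$, $\lambda>0$ and $c(x,y)=\|x-y\|^{p}$ (Euclidean norm). Let $\mathcal D:\mathcal P(\mathcal X)\times\mathcal P(\mathcal X)\to[0,\infty]$ satisfy $\mathcal D(\mathbb Q',\mathbb Q')=0$ for all $\mathbb Q'\in\mathcal P(\mathcal X)$. Assume that the first variation of $\mathbb Q'\mapsto\mathcal D(\mathbb Q',\mathbb Q)$ at $\mathbb Q'=\mathbb Q$ exists and is zero, meaning that for every finite signed Borel measure $\Delta$ on $\mathcal X$ of zero total mass, $$\mathcal D(\mathbb Q+\varepsilon\Delta,\mathbb Q)=\mathcal D(\mathbb Q,\mathbb Q)+o(\varepsilon)$$ as $\varepsilon\to0$ along those $\varepsilon\ge 0$ for which $\mathbb Q+\varepsilon\Delta\in\mathcal P(\mathcal X)$. Let $T^{\lambda}$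 be a minimizer, over all measurable maps $T:\mathcal X\to\mathcal X$, of the content-regularized GAN objective $$\mathcal D(T_{\#}\mathbb P,\mathbb Q)+\lambda\,\mathcal R_c(T),\qquad \mathcal R_c(T)=\int_{\mathcal X}c\big(x,T(x)\big)\,d\mathbb P(x).$$ Then $T^{\lambda}$ is biased, that is, $T^{\lambda}_{\#}\mathbb P\neq\mathbb Q$. -/

import Mathlib

open MeasureTheory
open scoped NNReal ENNReal

/-- The content loss `R_c(T) = ∫ c(x, T x) dP(x)` of a map `T` for a nonnegative cost `c`. -/
noncomputable def contentLoss {X Y : Type*} [MeasurableSpace X]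
    (c : X → Y → ℝ≥0) (P : ProbabilityMeasure X) (T : X → Y) : ℝ≥0∞ :=
  ∫⁻ x, (c x (T x) : ℝ≥0∞) ∂(P : Measure X)

/-- The content-regularized GAN objective `D(T#P, Q) + lam * R_c(T)`
of a measurable map `T : X → Y`. -/
noncomputable def ganObjective {X Y : Type*} [MeasurableSpace X] [MeasurableSpace Y]
    (D : ProbabilityMeasure Y → ProbabilityMeasure Y → ℝ≥0∞) (c : X → Y → ℝ≥0)
    (P : ProbabilityMeasure X) (Q : ProbabilityMeasure Y) (lam : ℝ≥0)
    (T : X → Y) (hT : Measurable T) : ℝ≥0∞ :=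
  D (P.map hT.aemeasurable) Q + (lam : ℝ≥0∞) * contentLoss c P T

/-- The measurable map `T` minimizes the content-regularized GAN objective
among all measurable maps `X → Y`. -/
def IsGANMinimizer {X Y : Type*} [MeasurableSpace X] [MeasurableSpace Y]
    (D : ProbabilityMeasure Y → ProbabilityMeasure Y → ℝ≥0∞) (c : X → Y → ℝ≥0)
    (P : ProbabilityMeasure X) (Q : ProbabilityMeasure Y) (lam : ℝ≥0)
    (T : X → Y) (hT : Measurable T) : Prop :=
  ∀ (S : X → Y) (hS : Measurable S),
    ganObjective D c P Q lam T hT ≤ ganObjective D c P Q lam S hS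

/-- The first variation of `G` at `Q` exists and is zero: `G Q` is finite and, for every signed
measure `Δ` of zero total mass, `G (Q + ε Δ) = G Q + o(ε)` as `ε → 0` along those `ε ≥ 0` for which
`Q + ε Δ` is a probability measure (called `Q'` below). The `o(ε)` is spelled out:
`|G Q' - G Q| ≤ η ε` once `ε` is small, written as two inequalities because `G` may be infinite. -/
def HasZeroFirstVariation {Y : Type*} [MeasurableSpace Y]
    (G : ProbabilityMeasure Y → ℝ≥0∞) (Q : ProbabilityMeasure Y) : Prop :=
  G Q ≠ ∞ ∧
    ∀ Δ : SignedMeasure Y, Δ Set.univ = 0 →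
      ∀ η : ℝ≥0, 0 < η → ∃ δ : ℝ≥0, 0 < δ ∧ ∀ ε : ℝ≥0, ε < δ →
        ∀ Q' : ProbabilityMeasure Y,
          (Q' : Measure Y).toSignedMeasure = (Q : Measure Y).toSignedMeasure + (ε : ℝ) • Δ →
            G Q' ≤ G Q + (η * ε : ℝ≥0) ∧ G Q ≤ G Q' + (η * ε : ℝ≥0)

/-- The cost `c(x, y) = ‖x - y‖ ^ p` (Euclidean norm) on a subset `K` of `ℝⁿ`. -/
noncomputable def powerCost {n : ℕ} {K : Set (EuclideanSpace ℝ (Fin n))} (p : ℝ) (x y : K) :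
    ℝ≥0 :=
  ‖(x : EuclideanSpace ℝ (Fin n)) - (y : EuclideanSpace ℝ (Fin n))‖₊ ^ p

/-! Suppose `T` carries `P` to `Q`. Its content loss `R` is positive, since otherwise `T = id`
almost everywhere and `P = Q`. For small `b`, moving the fraction `1 - b` of the mass by `T` and
leaving the rest fixed couples `P` with `(1 - b) Q + b P` at cost `(1 - b) R`: the regularizer falls
linearly in `b`, while the discrepancy grows only by `o(b)`, contradicting minimality.

A coupling is not a map. `exists_measurable_map_eq_snd_lintegral_le` replaces it, since `P` is
atomless, by a map with exactly the same image and arbitrarily small excess cost. No optimality of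
`T` for transport is needed. -/

section Transport

open Set unitInterval

/-! ### Transport maps from atomless measures -/

/-- The cumulative distribution function of an atomless probability measure is continuous. -/
theorem continuous_cdf_of_nullSingletonClass (μ : Measure ℝ) [IsProbabilityMeasure μ] [NullSingletonClass μ] :
    Continuous (ProbabilityTheory.cdf μ) := by
  refine continuous_iff_continuousAt.2 fun a => ?_
  have hmono := ProbabilityTheory.monotone_cdf μ
  refine (hmono.continuousAt_iff_leftLim_eq_rightLim).2 ?_
  have h := (ProbabilityTheory.cdf μ).measure_singleton a
  rw [ProbabilityTheory.measure_cdf, measure_singleton, eq_comm, ENNReal.ofReal_eq_zero] at h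
  rw [(ProbabilityTheory.cdf μ).rightLim_eq]
  exact le_antisymm (hmono.leftLim_le le_rfl) (by linarith)

/-- The probability integral transform: the cumulative distribution function of an atomless
probability measure pushes it forward to the uniform measure. -/
theorem exists_measurable_map_eq_volume_of_real (μ : Measure ℝ) [IsProbabilityMeasure μ]
    [NullSingletonClass μ] : ∃ g : ℝ → I, Measurable g ∧ μ.map g = volume := by
  let F := ProbabilityTheory.cdf μ
  have hF : Continuous F := continuous_cdf_of_nullSingletonClass μ
  let g : ℝ → I := fun x =>
    ⟨F x, ProbabilityTheory.cdf_nonneg μ x, ProbabilityTheory.cdf_le_one μ x⟩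
  have hg : Measurable g := (hF.subtype_mk _).measurable
  have hsurj : ∀ t : ℝ, 0 < t → t < 1 → ∃ a, F a = t := fun t h0 h1 =>
    mem_range_of_exists_le_of_exists_ge hF
      ((ProbabilityTheory.tendsto_cdf_atBot μ).eventually_le_const h0).exists
      ((ProbabilityTheory.tendsto_cdf_atTop μ).eventually_const_le h1).exists
  have := Measure.isProbabilityMeasure_map (μ := μ) hg.aemeasurable
  refine ⟨g, hg, Measure.ext_of_Iic _ _ fun t => ?_⟩
  rw [Measure.map_apply hg measurableSet_Iic, unitInterval.volume_Iic]
  refine le_antisymm ?_ ?_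
  -- `F` may be flat at level `t`, so a level `b > t` is used: `F x ≤ t < F a = b` forces `x ≤ a`.
  · refine le_of_forall_gt_imp_ge_of_dense fun b hb => ?_
    rcases le_or_gt 1 b with h1 | h1
    · exact prob_le_one.trans h1
    have hbt : b ≠ ∞ := (h1.trans ENNReal.one_lt_top).ne
    have hb' : (t : ℝ) < b.toReal := (ENNReal.ofReal_lt_iff_lt_toReal t.2.1 hbt).1 hb
    obtain ⟨a, ha⟩ := hsurj b.toReal (t.2.1.trans_lt hb')
      (by simpa using (ENNReal.toReal_lt_toReal hbt ENNReal.one_ne_top).2 h1)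
    calc μ (g ⁻¹' Iic t) ≤ μ (Iic a) := by
          refine measure_mono fun x hx => ?_
          have hx' : F x ≤ t := hx
          by_contra hxa
          have := ProbabilityTheory.monotone_cdf μ (not_le.1 hxa).le
          change F a ≤ F x at this
          linarith
      _ = b := by
          rw [← ProbabilityTheory.ofReal_cdf]
          change ENNReal.ofReal (F a) = b
          rw [ha, ENNReal.ofReal_toReal hbt]
  -- The levels 0 and 1 need not be attained by `F`.
  · rcases t.2.1.eq_or_lt with h0 | h0
    · simp [← h0]
    rcases t.2.2.eq_or_lt with h1 | h1
    · have : g ⁻¹' Iic t = univ := by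
        ext x
        simp only [mem_preimage, mem_Iic, mem_univ, iff_true, ← Subtype.coe_le_coe, h1]
        exact (g x).2.2
      simp [this, h1]
    obtain ⟨a, ha⟩ := hsurj t h0 h1
    rw [← ha]
    change ENNReal.ofReal (ProbabilityTheory.cdf μ a) ≤ _
    rw [ProbabilityTheory.ofReal_cdf]
    refine measure_mono fun x hx => ?_
    change F x ≤ t
    rw [← ha]
    exact ProbabilityTheory.monotone_cdf μ hx

/-- An atomless finite measure on a standard Borel space can be pushed forward to any finite
measure of the same total mass on a standard Borel space. -/
theorem exists_measurable_map_eq_of_nullSingletonClass {X Y : Type*} [MeasurableSpace X]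
    [StandardBorelSpace X] [MeasurableSpace Y] [StandardBorelSpace Y] [Nonempty Y]
    (μ : Measure X) [IsFiniteMeasure μ] [NullSingletonClass μ] (ν : Measure Y) (h : μ univ = ν univ) :
    ∃ f : X → Y, Measurable f ∧ μ.map f = ν := by
  rcases eq_or_ne μ 0 with rfl | hμ
  · refine ⟨fun _ => Classical.arbitrary Y, measurable_const, ?_⟩
    rw [Measure.map_zero, eq_comm, ← Measure.measure_univ_eq_zero, ← h]
    rfl
  have hμ0 : μ univ ≠ 0 := by simpa using hμ
  have hμt : μ univ ≠ ∞ := measure_ne_top μ univ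
  have hμp : IsProbabilityMeasure ((μ univ)⁻¹ • μ) :=
    ⟨by simp [ENNReal.inv_mul_cancel hμ0 hμt]⟩
  have hνp : IsProbabilityMeasure ((μ univ)⁻¹ • ν) :=
    ⟨by simp [← h, ENNReal.inv_mul_cancel hμ0 hμt]⟩
  -- The map factors through the line and the uniform law on `I`: embed, apply the distribution
  -- function, then realize the normalized `ν` as an image of the uniform law.
  obtain ⟨e, he⟩ := exists_measurableEmbedding_real X
  have hep := Measure.isProbabilityMeasure_map (μ := (μ univ)⁻¹ • μ) he.measurable.aemeasurable
  have hea : NullSingletonClass (((μ univ)⁻¹ • μ).map e) := ⟨fun x => by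
    rw [he.map_apply, Measure.smul_apply,
      ((subsingleton_singleton (a := x)).preimage he.injective).measure_zero, smul_zero]⟩
  obtain ⟨g, hg, hgμ⟩ := exists_measurable_map_eq_volume_of_real (((μ univ)⁻¹ • μ).map e)
  obtain ⟨k, hk, hkν⟩ := Measure.exists_measurable_map_eq ((μ univ)⁻¹ • ν)
  refine ⟨k ∘ g ∘ e, hk.comp (hg.comp he.measurable), ?_⟩
  have key : (μ univ)⁻¹ • μ.map (k ∘ g ∘ e) = (μ univ)⁻¹ • ν := by
    rw [← Measure.map_smul, ← Measure.map_map hk (hg.comp he.measurable),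
      ← Measure.map_map hg he.measurable, hgμ, hkν]
  have := congrArg (fun ρ => μ univ • ρ) key
  simpa [smul_smul, ENNReal.mul_inv_cancel hμ0 hμt] using this

/-! ### Approximating couplings by maps -/

/-- A coupling with atomless first marginal agrees with the graph of a map as long as the first
coordinate is only observed through a function with countably many values. -/
theorem exists_measurable_map_prodMk_eq {X Y ι : Type*} [MeasurableSpace X]
    [StandardBorelSpace X] [MeasurableSpace Y] [StandardBorelSpace Y] [Nonempty Y]
    [Countable ι] [MeasurableSpace ι] [MeasurableSingletonClass ι]
    (π : Measure (X × Y)) [IsFiniteMeasure π] [NullSingletonClass π.fst] {N : X → ι} (hN : Measurable N) :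
    ∃ S : X → Y, Measurable S ∧
      π.fst.map (fun x => (N x, S x)) = π.map (fun z => (N z.1, z.2)) := by
  have hNπ : Measurable fun z : X × Y => N z.1 := hN.comp measurable_fst
  -- On each fibre of `N` the atomless first marginal has the mass of the coupling there, so a map
  -- can reproduce its second marginal; these maps are then glued.
  have hex : ∀ i, ∃ f : X → Y, Measurable f ∧
      (π.fst.restrict (N ⁻¹' {i})).map f
        = (π.restrict ((fun z : X × Y => N z.1) ⁻¹' {i})).map Prod.snd := by
    intro i
    refine exists_measurable_map_eq_of_nullSingletonClass _ _ ?_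
    rw [Measure.map_apply measurable_snd .univ, Measure.restrict_apply .univ, preimage_univ,
      Measure.restrict_apply .univ, univ_inter, univ_inter,
      Measure.fst_apply (hN (measurableSet_singleton i))]
    rfl
  choose F hF hFπ using hex
  have hS : Measurable fun x => F (N x) x :=
    (measurable_from_prod_countable_right (f := fun z : ι × X => F z.1 z.2) hF).comp
      (hN.prodMk measurable_id)
  have hm₁ : Measurable fun x => (N x, F (N x) x) := hN.prodMk hS
  have hm₂ : Measurable fun z : X × Y => (N z.1, z.2) := hNπ.prodMk measurable_snd
  refine ⟨_, hS, (Measure.ext_iff_of_iUnion_eq_univ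
    (s := fun i : ι => (Prod.fst ⁻¹' {i} : Set (ι × Y))) (by ext; simp)).2 fun i => ?_⟩
  have hi : MeasurableSet (Prod.fst ⁻¹' {i} : Set (ι × Y)) :=
    measurable_fst (measurableSet_singleton i)
  ext A hA
  have hAi : MeasurableSet (Prod.mk i ⁻¹' A) := measurable_prodMk_left hA
  have h := congrArg (fun ρ => ρ (Prod.mk i ⁻¹' A)) (hFπ i)
  simp only [Measure.map_apply (hF i) hAi, Measure.map_apply measurable_snd hAi,
    Measure.restrict_apply (hF i hAi), Measure.restrict_apply (measurable_snd hAi)] at h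
  rw [Measure.restrict_apply hA, Measure.restrict_apply hA, Measure.map_apply hm₁ (hA.inter hi),
    Measure.map_apply hm₂ (hA.inter hi)]
  convert h using 2
  · ext x
    simp only [mem_preimage, mem_inter_iff, mem_singleton_iff]
    constructor <;> rintro ⟨h₁, rfl⟩ <;> exact ⟨h₁, rfl⟩
  · ext x
    simp only [mem_preimage, mem_inter_iff, mem_singleton_iff]
    constructor <;> rintro ⟨h₁, rfl⟩ <;> exact ⟨h₁, rfl⟩

/-- Every point of a separable metric space is close to a measurably chosen point of a sequence. -/
theorem exists_measurable_nat_dist_lt (X : Type*) [PseudoMetricSpace X]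
    [TopologicalSpace.SeparableSpace X] [Nonempty X] [MeasurableSpace X] [OpensMeasurableSpace X]
    {r : ℝ} (hr : 0 < r) :
    ∃ (u : ℕ → X) (N : X → ℕ), Measurable N ∧ ∀ x, dist x (u (N x)) < r := by
  classical
  let u := TopologicalSpace.denseSeq X
  have hex : ∀ x, ∃ k, dist x (u k) < r :=
    fun x => (TopologicalSpace.denseRange_denseSeq X).exists_dist_lt x hr
  exact ⟨u, fun x => Nat.find (hex x), measurable_find hex fun k =>
    (Metric.isOpen_ball (x := u k) (ε := r)).measurableSet, fun x => Nat.find_spec (hex x)⟩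

/-- Monge's relaxation: the cost of a coupling whose first marginal is atomless is approximated
by the cost of a transport map with the same marginals. -/
theorem exists_measurable_map_eq_snd_lintegral_le {X Y : Type*} [PseudoMetricSpace X]
    [TopologicalSpace.SeparableSpace X] [MeasurableSpace X] [OpensMeasurableSpace X]
    [StandardBorelSpace X] [Nonempty X]
    [PseudoMetricSpace Y] [MeasurableSpace Y] [OpensMeasurableSpace Y] [StandardBorelSpace Y]
    [Nonempty Y]
    {c : X × Y → ℝ≥0} (hc : UniformContinuous c)
    (π : Measure (X × Y)) [IsProbabilityMeasure π] [NullSingletonClass π.fst] {τ : ℝ≥0} (hτ : 0 < τ) :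
    ∃ S : X → Y, Measurable S ∧ π.fst.map S = π.snd ∧
      ∫⁻ x, c (x, S x) ∂π.fst ≤ ∫⁻ z, c z ∂π + τ := by
  -- Half of `τ` pays for replacing `x` by `u (N x)`, half for going back; in between, the integrand
  -- sees only `(N x, y)`, whose law is the same for map and coupling.
  obtain ⟨r, hr, hcr⟩ := Metric.uniformContinuous_iff.1 hc (τ / 2 : ℝ≥0) (by positivity)
  obtain ⟨u, N, hN, hNu⟩ := exists_measurable_nat_dist_lt X hr
  obtain ⟨S, hS, hSπ⟩ := exists_measurable_map_prodMk_eq π hN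
  have hclose : ∀ x y, (c (x, y) : ℝ≥0∞) ≤ c (u (N x), y) + (τ / 2 : ℝ≥0) ∧
      (c (u (N x), y) : ℝ≥0∞) ≤ c (x, y) + (τ / 2 : ℝ≥0) := by
    intro x y
    have h := hcr (a := (x, y)) (b := (u (N x), y)) (by simpa [Prod.dist_eq, hr] using hNu x)
    rw [NNReal.dist_eq, abs_lt] at h
    constructor <;> norm_cast <;> rw [← NNReal.coe_le_coe, NNReal.coe_add] <;> linarith [h.1, h.2]
  have hcu : Measurable fun z : ℕ × Y => (c (u z.1, z.2) : ℝ≥0∞) :=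
    measurable_from_prod_countable_right fun i =>
      (hc.continuous.comp
        (by fun_prop : Continuous fun y : Y => (u i, y))).measurable.coe_nnreal_ennreal
  have hm₁ : Measurable fun x => (N x, S x) := hN.prodMk hS
  have hm₂ : Measurable fun z : X × Y => (N z.1, z.2) :=
    (hN.comp measurable_fst).prodMk measurable_snd
  refine ⟨S, hS, ?_, ?_⟩
  · have h := congrArg (Measure.map Prod.snd) hSπ
    rwa [Measure.map_map measurable_snd hm₁, Measure.map_map measurable_snd hm₂] at h
  · calc ∫⁻ x, c (x, S x) ∂π.fst
        ≤ ∫⁻ x, (c (u (N x), S x) + (τ / 2 : ℝ≥0) : ℝ≥0∞) ∂π.fst :=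
          lintegral_mono fun x => (hclose x (S x)).1
      _ = ∫⁻ z, (c (u (N z.1), z.2) : ℝ≥0∞) ∂π + (τ / 2 : ℝ≥0) := by
          rw [lintegral_add_right _ measurable_const, lintegral_const, measure_univ, mul_one]
          congr 1
          have h := congrArg (fun ρ => ∫⁻ z, (c (u z.1, z.2) : ℝ≥0∞) ∂ρ) hSπ
          simpa only [lintegral_map hcu hm₁, lintegral_map hcu hm₂] using h
      _ ≤ ∫⁻ z, (c z + (τ / 2 : ℝ≥0) : ℝ≥0∞) ∂π + (τ / 2 : ℝ≥0) := by
          gcongr with z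
          exact (hclose z.1 z.2).2
      _ = ∫⁻ z, c z ∂π + τ := by
          rw [lintegral_add_right _ measurable_const, lintegral_const, measure_univ, mul_one,
            add_assoc, ← ENNReal.coe_add, add_halves]

end Transport

/-! ### Perturbing a minimizer -/

theorem contentLoss_ne_top {X : Type*} [MeasurableSpace X] [TopologicalSpace X] [CompactSpace X]
    {c : X → X → ℝ≥0} (hc : Continuous fun z : X × X => c z.1 z.2) (P : ProbabilityMeasure X)
    (T : X → X) : contentLoss c P T ≠ ∞ := by
  obtain ⟨M, hM⟩ := (isCompact_range hc).bddAbove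
  refine ne_top_of_le_ne_top (ENNReal.coe_ne_top (r := M)) ?_
  calc contentLoss c P T ≤ ∫⁻ _, (M : ℝ≥0∞) ∂(P : Measure X) :=
        lintegral_mono fun x => ENNReal.coe_le_coe.2 (hM ⟨(x, T x), rfl⟩)
    _ = M := by simp

/-- A map of zero content loss transports nothing. -/
theorem map_eq_self_of_contentLoss_eq_zero {X : Type*} [MeasurableSpace X] {c : X → X → ℝ≥0}
    (hc : Measurable fun z : X × X => c z.1 z.2) (hc0 : ∀ x y, c x y = 0 → x = y)
    (P : ProbabilityMeasure X) {T : X → X} (hT : Measurable T) (h : contentLoss c P T = 0) :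
    P.map hT.aemeasurable = P := by
  have hm : Measurable fun x => (c x (T x) : ℝ≥0∞) :=
    (hc.comp (measurable_id.prodMk hT)).coe_nnreal_ennreal
  have hae : T =ᵐ[(P : Measure X)] id := by
    filter_upwards [(lintegral_eq_zero_iff hm).1 h] with x hx
    exact (hc0 x (T x) (by simpa using hx)).symm
  apply Subtype.ext
  change (P : Measure X).map T = P
  rw [Measure.map_congr hae, Measure.map_id]

/-- Mixing the image of a transport map with the source measure scales the transport cost, up to
an arbitrarily small error. -/
theorem exists_measurable_map_eq_mix_contentLoss_le {X : Type*} [PseudoMetricSpace X]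
    [TopologicalSpace.SeparableSpace X] [MeasurableSpace X] [OpensMeasurableSpace X]
    [StandardBorelSpace X] [Nonempty X] {c : X → X → ℝ≥0}
    (hc : UniformContinuous fun z : X × X => c z.1 z.2) (hcd : ∀ x, c x x = 0)
    (P : ProbabilityMeasure X) [NullSingletonClass (P : Measure X)] {T : X → X}
    (hT : Measurable T) {a b τ : ℝ≥0} (hab : a + b = 1) (hτ : 0 < τ) :
    ∃ (S : X → X) (_ : Measurable S),
      (P : Measure X).map S = a • (P : Measure X).map T + b • (P : Measure X) ∧
      contentLoss c P S ≤ a * contentLoss c P T + τ := by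
  have hT' : Measurable fun x => (x, T x) := measurable_id.prodMk hT
  have hd : Measurable fun x : X => (x, x) := measurable_id.prodMk measurable_id
  let π : Measure (X × X) :=
    a • (P : Measure X).map (fun x => (x, T x)) + b • (P : Measure X).map (fun x => (x, x))
  have hfst : π.fst = P := by
    simp only [π, Measure.fst, Measure.map_add _ _ measurable_fst, Measure.map_smul,
      Measure.map_map measurable_fst hT', Measure.map_map measurable_fst hd]
    change a • (P : Measure X).map id + b • (P : Measure X).map id = P
    rw [Measure.map_id, ← add_smul, hab, one_smul]
  have hsnd : π.snd = a • (P : Measure X).map T + b • (P : Measure X) := by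
    simp only [π, Measure.snd, Measure.map_add _ _ measurable_snd, Measure.map_smul,
      Measure.map_map measurable_snd hT', Measure.map_map measurable_snd hd]
    change a • (P : Measure X).map T + b • (P : Measure X).map id = _
    rw [Measure.map_id]
  have hπ : IsProbabilityMeasure π := ⟨by
    rw [← Measure.fst_univ, hfst, measure_univ]⟩
  have hna : NullSingletonClass π.fst := by rw [hfst]; infer_instance
  obtain ⟨S, hS, hSπ, hcost⟩ := exists_measurable_map_eq_snd_lintegral_le hc π hτ
  rw [hfst, hsnd] at hSπ
  rw [hfst] at hcost
  refine ⟨S, hS, hSπ, hcost.trans_eq ?_⟩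
  have hcm : Measurable fun z : X × X => (c z.1 z.2 : ℝ≥0∞) :=
    hc.continuous.measurable.coe_nnreal_ennreal
  congr 1
  rw [lintegral_add_measure, lintegral_smul_measure, lintegral_smul_measure, lintegral_map hcm hT',
    lintegral_map hcm hd]
  simp only [hcd, ENNReal.coe_zero, lintegral_zero, smul_zero, add_zero]
  rfl

theorem toSignedMeasure_eq_add_smul_sub {X : Type*} [MeasurableSpace X]
    {P Q Q' : ProbabilityMeasure X} {a b : ℝ≥0} (hab : a + b = 1)
    (h : (Q' : Measure X) = a • (Q : Measure X) + b • (P : Measure X)) :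
    (Q' : Measure X).toSignedMeasure = (Q : Measure X).toSignedMeasure +
      (b : ℝ) • ((P : Measure X).toSignedMeasure - (Q : Measure X).toSignedMeasure) := by
  ext s hs
  have habR : (a : ℝ) + b = 1 := by exact_mod_cast hab
  have hQ' : (Q' : Measure X).real s = a * (Q : Measure X).real s + b * (P : Measure X).real s := by
    rw [h, measureReal_add_apply, measureReal_nnreal_smul_apply, measureReal_nnreal_smul_apply]
  simp only [add_apply, smul_apply, sub_apply,
    Measure.toSignedMeasure_apply_measurable hs, hQ', smul_eq_mul]
  linear_combination (Q : Measure X).real s * habR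

/-- If the discrepancy has zero first variation at the target measure, then a map transporting an
atomless measure to a different measure is never a minimizer of the regularized objective. -/
theorem map_ne_of_isGANMinimizer {X : Type*} [PseudoMetricSpace X] [CompactSpace X]
    [MeasurableSpace X] [OpensMeasurableSpace X] [StandardBorelSpace X] {c : X → X → ℝ≥0}
    (hc : Continuous fun z : X × X => c z.1 z.2) (hc0 : ∀ x y, c x y = 0 ↔ x = y)
    {P Q : ProbabilityMeasure X} [NullSingletonClass (P : Measure X)] (hPQ : P ≠ Q)
    {D : ProbabilityMeasure X → ProbabilityMeasure X → ℝ≥0∞} (hD : D Q Q = 0)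
    (hvar : HasZeroFirstVariation (fun Q' => D Q' Q) Q) {lam : ℝ≥0} (hlam : 0 < lam)
    {T : X → X} (hT : Measurable T) (hmin : IsGANMinimizer D c P Q lam T hT) :
    P.map hT.aemeasurable ≠ Q := by
  intro hTQ
  have hne : Nonempty X := P.nonempty
  obtain ⟨R, hR⟩ : ∃ R : ℝ≥0, (R : ℝ≥0∞) = contentLoss c P T :=
    ⟨_, ENNReal.coe_toNNReal (contentLoss_ne_top hc P T)⟩
  have hR0 : 0 < R := by
    refine pos_iff_ne_zero.2 fun h0 => hPQ ?_
    rw [← hTQ, map_eq_self_of_contentLoss_eq_zero hc.measurable (fun x y => (hc0 x y).1) P hT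
      (by rw [← hR, h0, ENNReal.coe_zero])]
  -- The penalty saves `lam * R * b`. Half of this is spent on the excess cost `b * R / 2` of the
  -- map and a quarter on the discrepancy, hence the slope `lam * R / 4`.
  obtain ⟨δ, hδ, hvarδ⟩ := hvar.2
    ((P : Measure X).toSignedMeasure - (Q : Measure X).toSignedMeasure)
    (by simp [Measure.toSignedMeasure_apply_measurable MeasurableSet.univ])
    (lam * R / 4) (by positivity)
  obtain ⟨b, hb0, hb⟩ := exists_between (lt_min hδ one_pos)
  have hab : (1 - b) + b = 1 := tsub_add_cancel_of_le (hb.le.trans (min_le_right _ _))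
  obtain ⟨S, hS, hSP, hScost⟩ := exists_measurable_map_eq_mix_contentLoss_le
    (CompactSpace.uniformContinuous_of_continuous hc) (fun x => (hc0 x x).2 rfl) P hT hab
    (show 0 < b * R / 2 by positivity)
  have hDS : D (P.map hS.aemeasurable) Q ≤ (lam * R / 4 * b : ℝ≥0) := by
    have hTQ' : (P : Measure X).map T = Q := congrArg Subtype.val hTQ
    rw [hTQ'] at hSP
    simpa [hD] using (hvarδ b (hb.trans_le (min_le_left _ _)) (P.map hS.aemeasurable)
      (toSignedMeasure_eq_add_smul_sub hab hSP)).1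
  have h := hmin S hS
  rw [ganObjective, ganObjective, hTQ, hD, zero_add] at h
  have h' := h.trans (add_le_add hDS (mul_le_mul_right hScost _))
  rw [← hR] at h'
  -- The right side equals `lam * R - lam * R * b / 4`, which is too small.
  have h'' : lam * R ≤ lam * R / 4 * b + lam * ((1 - b) * R + b * R / 2) := by exact_mod_cast h'
  have habR : ((1 - b : ℝ≥0) : ℝ) + b = 1 := by exact_mod_cast hab
  have hpos : (0 : ℝ) < lam * R * b := by positivity
  rw [← NNReal.coe_le_coe] at h''
  push_cast at h''
  rw [eq_sub_of_add_eq habR] at h''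
  nlinarith

theorem nullSingletonClass_of_map_val_absolutelyContinuous {n : ℕ}
    {K : Set (EuclideanSpace ℝ (Fin (n + 1)))} {μ : Measure K}
    (h : μ.map (Subtype.val : K → EuclideanSpace ℝ (Fin (n + 1))) ≪ volume) :
    NullSingletonClass μ := by
  refine ⟨fun x => ?_⟩
  have hx : μ.map (Subtype.val : K → EuclideanSpace ℝ (Fin (n + 1))) {x.1} = 0 :=
    h (measure_singleton _)
  rw [Measure.map_apply measurable_subtype_coe (measurableSet_singleton _)] at hx
  refine measure_mono_null ?_ hx
  simp

theorem mainTheorem2 (n : ℕ) (K : Set (EuclideanSpace ℝ (Fin n)))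
    (hK : IsCompact K) (hKfr : volume (frontier K) = 0)
    (P Q : ProbabilityMeasure K)
    (hP : (P : Measure K).map (Subtype.val : K → EuclideanSpace ℝ (Fin n)) ≪ volume)
    (hPQ : P ≠ Q)
    (p : ℝ) (hp : 1 < p)
    (D : ProbabilityMeasure K → ProbabilityMeasure K → ℝ≥0∞)
    (hD : ∀ Q' : ProbabilityMeasure K, D Q' Q' = 0)
    (hvar : HasZeroFirstVariation (fun Q' => D Q' Q) Q)
    (lam : ℝ≥0) (hlam : 0 < lam)
    (T : K → K) (hT : Measurable T)
    (hmin : IsGANMinimizer D (powerCost p) P Q lam T hT) :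
    P.map hT.aemeasurable ≠ Q := by

  have : CompactSpace K := isCompact_iff_compactSpace.1 hK
  have : PolishSpace K := hK.isClosed.polishSpace
  rcases n with _ | n
  -- In dimension 0 Lebesgue measure has an atom, so absolute continuity does not exclude atoms; but
  -- a space with at most one point carries at most one probability measure.
  · refine absurd (Subtype.ext (Measure.ext fun s _ => ?_)) hPQ
    rcases Set.eq_empty_or_nonempty s with rfl | hs
    · simp
    · have := Subsingleton.eq_univ_of_nonempty hs
      simp [this]
  have := nullSingletonClass_of_map_val_absolutelyContinuous hP
  refine map_ne_of_isGANMinimizer ?_ (fun x y => ?_) hPQ (hD Q) hvar hlam hT hmin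
  · exact (NNReal.continuous_rpow_const (by linarith)).comp (by fun_prop)
  · rw [powerCost, NNReal.rpow_eq_zero (by linarith), nnnorm_eq_zero, sub_eq_zero,
      Subtype.coe_inj]
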